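/- For an integer matrix $M\in\{0,1\}^{n\times m}$ with $n,m\ge 1$ let $r_i=\sum_j M_{i,j}$ and $c_j=\sum_i M_{i,j}$ be its row and column sums, and let $\mathrm{disc}(M)=\min_{\chi\in\{1,-1\}^m}\|M\chi\|_\infty$. For a real number $\alpha$, $M$ is called $\alpha$-balanced if all $r_i$ and $c_j$ are positive and $\frac1\alpha\le\frac{c_j}{c_{j'}}\le\alpha$, $\frac1\alpha\le\frac{r_i}{r_{i'}}\le\alpha$ and $\frac1\alpha\le\frac{r_i}{c_j}\le\alpha$ for all rows $i,i'$ and all columns $j,j'$. The majority matching-pennies game of $M$ has $n+m$ players, one for each row and one for each column. Each player has the two actions $1$ and $-1$, and chooses whether to multiply all entries of his row or column by $-1$. If row player $i$ plays $a_i$ and column player $j$ plays $b_j$, then row player $i$ receives the payoff $\mathrm{sign}\big(\sum_j a_ib_jM_{i,j}\big)\in\{-1,0,1\}$ and column player $j$ receives $-\,\mathrm{sign}\big(\sum_i a_ib_jM_{i,j}\big)$. A mixed strategy is the probability $x\in[0,1]$ of playing $1$, players randomize independently, and payoffs of mixed profiles are expected payoffs. A mixed profile is an $\varepsilon$-Nash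 equilibrium if no player can gain more than $\varepsilon$ by a unilateral deviation to one of his actions. Theorem. For every real constant $\alpha$, the following two statements are equivalent. (1) ($\alpha$-balanced Beck–Fiala conjecture.) There is a constant $C=C(\alpha)$ such that $\mathrm{disc}(M)\le C\sqrt{t}$, where $t=r_1$, for all $n,m\ge1$ and every $\alpha$-balanced matrix $M\in\{0,1\}^{n\times m}$. (2) (Existence of a close approximate equilibrium for $\alpha$-balanced games.) There is an odd positive integer $k=k(\alpha)$ such that, for all $n,m\ge1$ and every $\alpha$-balanced matrix $M\in\{0,1\}^{n\times m}$, at least one of the $2^{n+m}$ mixed profiles in which every coordinate is $\frac{k+1}{2k}$ or $\frac{k-1}{2k}$ is a $0.4$-Nash equilibrium of the majority matching-pennies game of $M$. -/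

import Mathlib

open scoped Matrix

/-! ### Discrepancy and balanced matrices -/

/-- `r_i`, the sum of row `i`. -/
def rowSum {n m : ℕ} (M : Matrix (Fin n) (Fin m) ℤ) (i : Fin n) : ℤ := ∑ j, M i j

/-- `c_j`, the sum of column `j`. -/
def colSum {n m : ℕ} (M : Matrix (Fin n) (Fin m) ℤ) (j : Fin m) : ℤ := ∑ i, M i j

/-- `disc(M)`: the minimum of `‖M χ‖_∞` over all `χ ∈ {1, -1}^m`.
The units of `ℤ` are exactly `1` and `-1`, and the norm of `Fin n → ℤ` is the sup norm. -/
noncomputable def disc {n m : ℕ} (M : Matrix (Fin n) (Fin m) ℤ) : ℝ :=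
  Finset.univ.inf' Finset.univ_nonempty
    (fun χ : Fin m → ℤˣ => ‖M *ᵥ (fun j => (χ j : ℤ))‖)

/-- `M` is a 0/1 matrix, and any two of its row and column sums are within a factor `α` of
each other. The positivity of the sums says that the quotients make sense. -/
structure IsBalanced {n m : ℕ} (α : ℝ) (M : Matrix (Fin n) (Fin m) ℤ) : Prop where
  zero_or_one : ∀ i j, M i j = 0 ∨ M i j = 1
  row_pos : ∀ i, 0 < rowSum M i
  col_pos : ∀ j, 0 < colSum M j
  col_col : ∀ j j', 1 / α ≤ (colSum M j : ℝ) / colSum M j' ∧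
    (colSum M j : ℝ) / colSum M j' ≤ α
  row_row : ∀ i i', 1 / α ≤ (rowSum M i : ℝ) / rowSum M i' ∧
    (rowSum M i : ℝ) / rowSum M i' ≤ α
  row_col : ∀ i j, 1 / α ≤ (rowSum M i : ℝ) / colSum M j ∧
    (rowSum M i : ℝ) / colSum M j ≤ α

/-- The `α`-balanced Beck–Fiala conjecture: `disc(M) = O(√t)` with `t = r_1` (the first row
has index `0`), with one constant for all `α`-balanced matrices of all sizes. -/
def BalancedBeckFialaConjecture (α : ℝ) : Prop :=
  ∃ C : ℝ, ∀ (n m : ℕ) [NeZero n] [NeZero m] (M : Matrix (Fin n) (Fin m) ℤ),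
    IsBalanced α M → disc M ≤ C * √(rowSum M 0 : ℝ)

/-! ### Games with the two actions `1` and `-1` -/

/-- A game with set of players `P` in which every player has the two actions `1` and `-1`:
`utility p a` is the payoff of player `p` at the profile `a` of pure actions. -/
structure BinaryGame (P : Type) where
  utility : P → (P → ℤˣ) → ℝ

namespace BinaryGame

/-- The probability of the action `b` under the mixed strategy `q ∈ [0, 1]`, where `q` is the
probability of the action `1`. -/
def actionProb (q : ℝ) (b : ℤˣ) : ℝ := if b = 1 then q else 1 - q

/-- The mixed strategy that plays the action `b` with probability one. -/
def pureStrategy (b : ℤˣ) : ℝ := if b = 1 then 1 else 0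

variable {P : Type} [Fintype P] [DecidableEq P]

/-- The expected payoff of player `p` when the players act independently, each player `q`
playing the action `1` with probability `x q`. -/
noncomputable def expectedUtility (G : BinaryGame P) (p : P) (x : P → ℝ) : ℝ :=
  ∑ a : P → ℤˣ, (∏ q, actionProb (x q) (a q)) * G.utility p a

/-- `x` is an `ε`-Nash equilibrium: a profile of mixed strategies in which no player gains more
than `ε` by a unilateral deviation to one of the two actions. -/
def IsApproxNash (G : BinaryGame P) (ε : ℝ) (x : P → ℝ) : Prop :=
  (∀ p, x p ∈ Set.Icc (0 : ℝ) 1) ∧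
  ∀ (p : P) (b : ℤˣ),
    G.expectedUtility p x ≥ G.expectedUtility p (Function.update x p (pureStrategy b)) - ε

end BinaryGame

/-- The majority matching-pennies game of `M`. The players are the rows `Sum.inl i` and the
columns `Sum.inr j`, and each chooses the factor `1` or `-1` by which his row or column is
multiplied. A row player gets the sign of the resulting sum of his row, a column player gets
the opposite of the sign of the resulting sum of his column. -/
def majorityGame {n m : ℕ} (M : Matrix (Fin n) (Fin m) ℤ) : BinaryGame (Fin n ⊕ Fin m) where
  utility p a :=
    match p with
    | Sum.inl i =>
        (Int.sign (∑ j, (a (Sum.inl i) : ℤ) * (a (Sum.inr j) : ℤ) * M i j) : ℝ)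
    | Sum.inr j =>
        -(Int.sign (∑ i, (a (Sum.inl i) : ℤ) * (a (Sum.inr j) : ℤ) * M i j) : ℝ)

/-- Existence of an approximate equilibrium close to `1/2` for `α`-balanced games: there is one
grid size `k` (odd, so that the two points of the grid `{0, 1/k, …, 1}` closest to `1/2` are
`(k ± 1) / (2k)`) such that in the game of every `α`-balanced matrix some profile with all
coordinates equal to `(k + 1) / (2k)` or `(k - 1) / (2k)` is a `0.4`-Nash equilibrium. -/
def CloseEquilibriumConjecture (α : ℝ) : Prop :=
  ∃ k : ℕ, Odd k ∧ ∀ (n m : ℕ) [NeZero n] [NeZero m] (M : Matrix (Fin n) (Fin m) ℤ),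
    IsBalanced α M → ∃ x : Fin n ⊕ Fin m → ℝ,
      (∀ p, x p = ((k : ℝ) + 1) / (2 * k) ∨ x p = ((k : ℝ) - 1) / (2 * k)) ∧
      (majorityGame M).IsApproxNash 0.4 x

/-!
A row or column player of the majority game receives `±` his own action times the majority of the
players that meet him, so a mixed profile `x` is an approximate equilibrium as soon as all expected
majorities `meanSign x s` are small, and an expected majority can only be large at an equilibrium
if the player exploits it almost fully (`majorityGame_isApproxNash_iff`).

From an equilibrium to a colouring: for `k ≥ 3` no player on the grid points next to `1 / 2` exploits
a majority fully, so every expected majority is at most `3 / 5`. The sum of the actions in a row has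
variance at most the row sum `r`, and its mean is `1 / k` times the discrepancy of the row under the
colouring that rounds `x`; by Chebyshev's inequality (`sq_mul_one_sub_abs_meanSign_le`) this
discrepancy is `O(k √r)`. For `k = 1` the equilibrium is pure, and the zero-sum structure forces all
row totals to vanish (`disc_eq_zero_of_pure`).

From colourings to an equilibrium: colour the columns of `M` and of its transpose with discrepancy
`O(√r)`, and let every player have the bias `±1 / k` that his colour indicates. In each row,
all but `d = O(√r)` of the biases cancel in `q` pairs. The sign of a walk made of such pairs alone
has mean zero by symmetry, and the extra bias `1 / k` of the `d` remaining steps changes this mean by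
at most `d / k` times a point probability of the paired walk, which is `O(1 / √q)`. The point
probabilities are bounded by writing a pair of steps with opposite biases as a lazy pair of fair
steps, so that the paired walk is a mixture of fair walks (`abs_lazyWalk_pow_sign_sub_le`). Hence all
expected majorities are `O(1 / k)` (`abs_meanSign_le`), with a constant that depends on `α` only.
-/

/-! ### Expectations over mixed profiles -/

namespace BinaryGame

variable {P : Type} [DecidableEq P]

/-- The sum of the actions of the players in `s`. -/
def actionSum (s : Finset P) (a : P → ℤˣ) : ℤ := ∑ q ∈ s, (a q : ℤ)

theorem actionSum_update_of_notMem {s : Finset P} {p : P} (hp : p ∉ s) (a : P → ℤˣ) (b : ℤˣ) :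
    actionSum s (Function.update a p b) = actionSum s a :=
  Finset.sum_congr rfl fun q hq => by
    rw [Function.update_of_ne (ne_of_mem_of_not_mem hq hp)]

theorem actionSum_insert_update {s : Finset P} {p : P} (hp : p ∉ s) (a : P → ℤˣ) (b : ℤˣ) :
    actionSum (insert p s) (Function.update a p b) = b + actionSum s a := by
  rw [← actionSum_update_of_notMem hp a b, actionSum, Finset.sum_insert hp,
    Function.update_self, actionSum]

variable [Fintype P]

/-- The expectation of `f` at a random profile of pure actions, when the players act
independently and player `q` plays the action `1` with probability `x q`. -/
noncomputable def profileExp (x : P → ℝ) (f : (P → ℤˣ) → ℝ) : ℝ :=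
  ∑ a : P → ℤˣ, (∏ q, actionProb (x q) (a q)) * f a

theorem sum_units (f : ℤˣ → ℝ) : ∑ b, f b = f 1 + f (-1) := by
  rw [show (Finset.univ : Finset ℤˣ) = {1, -1} from rfl, Finset.sum_pair (by decide)]

@[simp] theorem actionProb_one (y : ℝ) : actionProb y 1 = y := by simp [actionProb]

@[simp] theorem actionProb_neg_one (y : ℝ) : actionProb y (-1) = 1 - y := by
  rw [actionProb, if_neg (by decide)]

theorem profileExp_const (x : P → ℝ) (c : ℝ) : profileExp x (fun _ => c) = c := by
  have h : ∑ a : P → ℤˣ, ∏ q, actionProb (x q) (a q) = 1 := by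
    rw [← Fintype.prod_sum]
    simp
  rw [profileExp, ← Finset.sum_mul, h, one_mul]

theorem profileExp_add (x : P → ℝ) (f g : (P → ℤˣ) → ℝ) :
    profileExp x (fun a => f a + g a) = profileExp x f + profileExp x g := by
  simp only [profileExp, mul_add, Finset.sum_add_distrib]

theorem profileExp_mul_left (x : P → ℝ) (c : ℝ) (f : (P → ℤˣ) → ℝ) :
    profileExp x (fun a => c * f a) = c * profileExp x f := by
  simp only [profileExp, Finset.mul_sum]
  exact Finset.sum_congr rfl fun a _ => by ring

theorem profileExp_mono {x : P → ℝ} (hx : ∀ p, x p ∈ Set.Icc (0 : ℝ) 1)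
    {f g : (P → ℤˣ) → ℝ} (h : ∀ a, f a ≤ g a) : profileExp x f ≤ profileExp x g := by
  refine Finset.sum_le_sum fun a _ => mul_le_mul_of_nonneg_left (h a) ?_
  refine Finset.prod_nonneg fun q _ => ?_
  unfold actionProb
  split_ifs
  · exact (hx q).1
  · linarith [(hx q).2]

/-- Independence of one player from the others: the strategy `y` of player `p` can be averaged
separately. -/
theorem profileExp_update (x : P → ℝ) (p : P) (y : ℝ) (f : (P → ℤˣ) → ℝ) :
    profileExp (Function.update x p y) f =
      y * profileExp x (fun a => f (Function.update a p 1)) +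
        (1 - y) * profileExp x (fun a => f (Function.update a p (-1))) := by
  -- Exchanging a fresh action of `p` with the action in the profile preserves the joint weight.
  let σ : (P → ℤˣ) × ℤˣ ≃ (P → ℤˣ) × ℤˣ :=
    { toFun := fun c => (Function.update c.1 p c.2, c.1 p)
      invFun := fun c => (Function.update c.1 p c.2, c.1 p)
      left_inv := fun c => by simp
      right_inv := fun c => by simp }
  have hw : ∀ (a : P → ℤˣ) (b : ℤˣ),
      (∏ q, actionProb (Function.update x p y q) (Function.update a p b q)) *
        actionProb (x p) (a p) = (∏ q, actionProb (x q) (a q)) * actionProb y b := by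
    intro a b
    rw [← Finset.mul_prod_erase _ _ (Finset.mem_univ p),
      ← Finset.mul_prod_erase Finset.univ (fun q => actionProb (x q) (a q)) (Finset.mem_univ p)]
    have : ∏ q ∈ Finset.univ.erase p,
        actionProb (Function.update x p y q) (Function.update a p b q) =
        ∏ q ∈ Finset.univ.erase p, actionProb (x q) (a q) :=
      Finset.prod_congr rfl fun q hq => by
        rw [Function.update_of_ne (Finset.ne_of_mem_erase hq),
          Function.update_of_ne (Finset.ne_of_mem_erase hq)]
    rw [this]
    simp only [Function.update_self]
    ring
  have h1 : profileExp (Function.update x p y) f =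
      ∑ c : (P → ℤˣ) × ℤˣ, ((∏ q, actionProb (Function.update x p y q) (c.1 q)) *
        actionProb (x p) c.2) * f c.1 := by
    rw [Fintype.sum_prod_type, profileExp]
    refine Finset.sum_congr rfl fun a _ => ?_
    rw [sum_units]
    simp only [actionProb_one, actionProb_neg_one]
    ring
  rw [h1, ← Equiv.sum_comp σ, Fintype.sum_prod_type]
  simp only [σ, Equiv.coe_fn_mk, hw, profileExp, Finset.mul_sum, ← Finset.sum_add_distrib]
  refine Finset.sum_congr rfl fun a _ => ?_
  rw [sum_units]
  simp only [actionProb_one, actionProb_neg_one]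
  ring

theorem profileExp_eq_split (x : P → ℝ) (p : P) (f : (P → ℤˣ) → ℝ) :
    profileExp x f = x p * profileExp x (fun a => f (Function.update a p 1)) +
      (1 - x p) * profileExp x (fun a => f (Function.update a p (-1))) := by
  conv_lhs => rw [← Function.update_eq_self p x]
  exact profileExp_update x p (x p) f

theorem profileExp_pureStrategy (c : P → ℤˣ) (f : (P → ℤˣ) → ℝ) :
    profileExp (fun p => pureStrategy (c p)) f = f c := by
  have h : ∀ b b' : ℤˣ, actionProb (pureStrategy b) b' = if b' = b then 1 else 0 := by
    intro b b'
    rcases Int.units_eq_one_or b with rfl | rfl <;> rcases Int.units_eq_one_or b' with rfl | rfl <;>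
      simp [pureStrategy]
  simp only [profileExp, h]
  rw [Finset.sum_eq_single c]
  · simp
  · intro a _ ha
    obtain ⟨q, hq⟩ := Function.ne_iff.mp ha
    rw [Finset.prod_eq_zero (Finset.mem_univ q) (if_neg hq), zero_mul]
  · simp

/-- The expected majority `E[sign (∑ q ∈ s, a q)]` of the actions of the players in `s`. -/
noncomputable def meanSign (x : P → ℝ) (s : Finset P) : ℝ :=
  profileExp x (fun a => ((actionSum s a).sign : ℝ))

/-- The payoff of a player who receives his own action times `ε` times the majority of the
players in `s`, when he deviates to the mixed strategy `y`. -/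
theorem expectedUtility_update (G : BinaryGame P) {p : P} {s : Finset P} (hp : p ∉ s) {ε : ℝ}
    (hu : ∀ a, G.utility p a = ε * ((a p : ℤ) : ℝ) * ((actionSum s a).sign : ℝ))
    (x : P → ℝ) (y : ℝ) :
    G.expectedUtility p (Function.update x p y) = (2 * y - 1) * (ε * meanSign x s) := by
  change profileExp _ (G.utility p) = _
  rw [profileExp_update]
  simp only [hu, Function.update_self, actionSum_update_of_notMem hp, meanSign]
  rw [profileExp_mul_left, profileExp_mul_left]
  push_cast
  ring

theorem expectedUtility_eq (G : BinaryGame P) {p : P} {s : Finset P} (hp : p ∉ s) {ε : ℝ}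
    (hu : ∀ a, G.utility p a = ε * ((a p : ℤ) : ℝ) * ((actionSum s a).sign : ℝ)) (x : P → ℝ) :
    G.expectedUtility p x = (2 * x p - 1) * (ε * meanSign x s) := by
  rw [← expectedUtility_update G hp hu x (x p), Function.update_eq_self]

theorem two_mul_pureStrategy_sub_one (b : ℤˣ) : 2 * pureStrategy b - 1 = ((b : ℤ) : ℝ) := by
  rcases Int.units_eq_one_or b with rfl | rfl
  · norm_num [pureStrategy]
  · norm_num [pureStrategy]

/-! ### The second moment of a sum of actions -/

theorem profileExp_sq_sum (x : P → ℝ) (s : Finset P) (v : ℝ) :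
    profileExp x (fun a => (v + (actionSum s a - ∑ q ∈ s, (2 * x q - 1))) ^ 2) =
      v ^ 2 + ∑ q ∈ s, (1 - (2 * x q - 1) ^ 2) := by
  induction s using Finset.induction_on generalizing v with
  | empty => simp [actionSum, profileExp_const]
  | insert p s hp ih =>
    have h : ∀ b : ℤˣ, profileExp x (fun a => (v + (actionSum (insert p s)
        (Function.update a p b) - ∑ q ∈ insert p s, (2 * x q - 1))) ^ 2) =
        (v + (b : ℤ) - (2 * x p - 1)) ^ 2 + ∑ q ∈ s, (1 - (2 * x q - 1) ^ 2) := by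
      intro b
      rw [← ih]
      congr 1
      funext a
      rw [actionSum_insert_update hp, Finset.sum_insert hp]
      push_cast
      ring
    rw [profileExp_eq_split x p, h, h, Finset.sum_insert hp]
    push_cast
    ring

/-- Chebyshev's inequality: if the mean of a sum of actions is large against the square root of
the number of players, then the majority is almost determined. -/
theorem sq_mul_one_sub_abs_meanSign_le {x : P → ℝ} (hx : ∀ p, x p ∈ Set.Icc (0 : ℝ) 1)
    (s : Finset P) :
    (∑ q ∈ s, (2 * x q - 1)) ^ 2 * (1 - |meanSign x s|) ≤ 2 * (s.card : ℝ) := by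
  have hvar : profileExp x (fun a => ((actionSum s a : ℝ) - ∑ q ∈ s, (2 * x q - 1)) ^ 2) ≤
      (s.card : ℝ) := by
    have h := profileExp_sq_sum x s 0
    simp only [zero_add] at h
    rw [h]
    calc (0 : ℝ) ^ 2 + ∑ q ∈ s, (1 - (2 * x q - 1) ^ 2) ≤ ∑ q ∈ s, (1 : ℝ) := by
          rw [zero_pow two_ne_zero, zero_add]
          exact Finset.sum_le_sum fun q _ => by nlinarith [sq_nonneg (2 * x q - 1)]
      _ = s.card := by simp
  set μ := ∑ q ∈ s, (2 * x q - 1)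
  -- `ε` is the sign of the mean; where the sign of the sum differs, the deviation exceeds `|μ|`.
  have key : ∀ ε : ℝ, (ε = 1 ∨ ε = -1) → 0 ≤ ε * μ →
      μ ^ 2 * (1 - |meanSign x s|) ≤ 2 * (s.card : ℝ) := by
    intro ε hε hμ
    have hpt : ∀ a, μ ^ 2 + (-2) * ((actionSum s a : ℝ) - μ) ^ 2 ≤
        (ε * μ ^ 2) * ((actionSum s a).sign : ℝ) := by
      intro a
      generalize actionSum s a = S
      rcases lt_trichotomy S 0 with h | rfl | h
      · have hS : (S : ℝ) < 0 := by exact_mod_cast h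
        rw [Int.sign_eq_neg_one_of_neg h]
        push_cast
        rcases hε with rfl | rfl <;> nlinarith [sq_nonneg ((S : ℝ) - μ)]
      · simp
        nlinarith [sq_nonneg μ]
      · have hS : (0 : ℝ) < S := by exact_mod_cast h
        rw [Int.sign_eq_one_of_pos h]
        push_cast
        rcases hε with rfl | rfl <;> nlinarith [sq_nonneg ((S : ℝ) - μ)]
    have h := profileExp_mono hx hpt
    rw [profileExp_add, profileExp_const, profileExp_mul_left, profileExp_mul_left] at h
    change _ ≤ ε * μ ^ 2 * meanSign x s at h
    have habs : ε * meanSign x s ≤ |meanSign x s| := by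
      rcases hε with rfl | rfl
      · simpa using le_abs_self _
      · simpa using neg_le_abs _
    nlinarith [mul_le_mul_of_nonneg_left habs (sq_nonneg μ)]
  rcases le_total 0 μ with h | h
  · exact key 1 (Or.inl rfl) (by linarith)
  · exact key (-1) (Or.inr rfl) (by linarith)

end BinaryGame

/-! ### Steps of a biased walk on the integers -/

/-- Averaging over one step of the walk on `ℤ` that moves by `1` with probability `(1 + β) / 2`
and by `-1` with probability `(1 - β) / 2`, as an operator on functions. -/
noncomputable def walkStep (β : ℝ) : Module.End ℝ (ℤ → ℝ) :=
  ((1 + β) / 2) • LinearMap.funLeft ℝ ℝ (fun v : ℤ => v + 1) +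
    ((1 - β) / 2) • LinearMap.funLeft ℝ ℝ (fun v : ℤ => v - 1)

theorem walkStep_apply (β : ℝ) (f : ℤ → ℝ) (v : ℤ) :
    walkStep β f v = (1 + β) / 2 * f (v + 1) + (1 - β) / 2 * f (v - 1) := by
  simp [walkStep, LinearMap.funLeft_apply]

theorem walkStep_commute (β γ : ℝ) : Commute (walkStep β) (walkStep γ) := by
  refine LinearMap.ext fun f => funext fun v => ?_
  simp only [Module.End.mul_apply, walkStep_apply]
  rw [show v + 1 - 1 = v by ring, show v - 1 + 1 = v by ring]
  ring

/-- One step with bias `β` followed by one with bias `-β` is a lazy unbiased double step. -/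
theorem walkStep_mul_walkStep_neg (β : ℝ) :
    walkStep β * walkStep (-β) = (1 - β ^ 2) • walkStep 0 ^ 2 + β ^ 2 • 1 := by
  refine LinearMap.ext fun f => funext fun v => ?_
  simp only [Module.End.mul_apply, walkStep_apply, pow_two (walkStep 0), LinearMap.add_apply,
    LinearMap.smul_apply, Pi.add_apply, Pi.smul_apply, smul_eq_mul, Module.End.one_apply]
  rw [show v + 1 - 1 = v by ring, show v - 1 + 1 = v by ring]
  ring

theorem abs_walkStep_apply_le {β : ℝ} (hβ : |β| ≤ 1) {f : ℤ → ℝ} {B : ℝ} (hf : ∀ v, |f v| ≤ B)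
    (v : ℤ) : |walkStep β f v| ≤ B := by
  have hβ' := abs_le.mp hβ
  have h1 := abs_le.mp (hf (v + 1))
  have h2 := abs_le.mp (hf (v - 1))
  rw [walkStep_apply, abs_le]
  constructor <;> nlinarith

theorem walkStep_zero_pow_odd {f : ℤ → ℝ} (hf : ∀ v, f (-v) = -f v) (d : ℕ) (v : ℤ) :
    (walkStep 0 ^ d) f (-v) = -(walkStep 0 ^ d) f v := by
  induction d generalizing v with
  | zero => exact hf v
  | succ d ih =>
    rw [pow_succ', Module.End.mul_apply, walkStep_apply, walkStep_apply,
      show -v + 1 = -(v - 1) by ring, show -v - 1 = -(v + 1) by ring, ih, ih]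
    ring

theorem walkStep_mul_walkStep_neg_pow_odd (β : ℝ) {f : ℤ → ℝ} (hf : ∀ v, f (-v) = -f v) (q : ℕ)
    (v : ℤ) : ((walkStep β * walkStep (-β)) ^ q) f (-v) =
      -((walkStep β * walkStep (-β)) ^ q) f v := by
  induction q generalizing v with
  | zero => exact hf v
  | succ q ih =>
    rw [pow_succ', Module.End.mul_apply]
    simp only [Module.End.mul_apply, walkStep_apply]
    rw [show -v + 1 + 1 = -(v - 1 - 1) by ring, show -v - 1 - 1 = -(v + 1 + 1) by ring,
      show -v + 1 - 1 = -v by ring, show -v - 1 + 1 = -v by ring,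
      show v + 1 - 1 = v by ring, show v - 1 + 1 = v by ring, ih, ih, ih]
    ring

/-- Replacing the bias `0` by the bias `β` in each of `d` steps changes the average of `f` by at
most `d |β| / 2` times the largest double increment of `f`. -/
theorem abs_walkStep_pow_sub_le {β : ℝ} (hβ : |β| ≤ 1) {f : ℤ → ℝ} {B : ℝ}
    (hf : ∀ v, |f (v + 1) - f (v - 1)| ≤ B) (d : ℕ) (v : ℤ) :
    |(walkStep β ^ d) f v - (walkStep 0 ^ d) f v| ≤ d * (|β| / 2 * B) := by
  have hD : ∀ (d : ℕ) (v : ℤ),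
      |(walkStep 0 ^ d) f (v + 1) - (walkStep 0 ^ d) f (v - 1)| ≤ B := by
    intro d
    induction d with
    | zero => exact hf
    | succ d ih =>
      intro v
      have h1 := abs_le.mp (ih (v + 1))
      have h2 := abs_le.mp (ih (v - 1))
      rw [pow_succ', Module.End.mul_apply, walkStep_apply, walkStep_apply, abs_le]
      rw [show v + 1 - 1 = v - 1 + 1 by ring] at *
      constructor <;> linarith
  induction d generalizing v with
  | zero => simp
  | succ d ih =>
    have hsplit : (walkStep β ^ (d + 1)) f v - (walkStep 0 ^ (d + 1)) f v =
        walkStep β ((walkStep β ^ d) f - (walkStep 0 ^ d) f) v +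
          β / 2 * ((walkStep 0 ^ d) f (v + 1) - (walkStep 0 ^ d) f (v - 1)) := by
      simp only [pow_succ', Module.End.mul_apply, walkStep_apply, Pi.sub_apply]
      ring
    rw [hsplit]
    refine (abs_add_le _ _).trans ?_
    have h1 : |walkStep β ((walkStep β ^ d) f - (walkStep 0 ^ d) f) v| ≤ d * (|β| / 2 * B) :=
      abs_walkStep_apply_le hβ ih v
    have h2 : |β / 2 * ((walkStep 0 ^ d) f (v + 1) - (walkStep 0 ^ d) f (v - 1))| ≤
        |β| / 2 * B := by
      rw [abs_mul, abs_div, abs_two]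
      exact mul_le_mul_of_nonneg_left (hD d v) (by positivity)
    push_cast
    linarith

/-! ### Anticoncentration -/

theorem centralBinom_div_four_pow_le (j : ℕ) :
    (j.centralBinom : ℝ) / 4 ^ j ≤ 1 / √((j : ℝ) + 1) := by
  have h : ∀ j : ℕ, ((j.centralBinom : ℝ)) ^ 2 * (2 * j + 1) ≤ (4 ^ j) ^ 2 := by
    intro j
    induction j with
    | zero => simp
    | succ j ih =>
      have hrec : ((j : ℝ) + 1) * (j + 1).centralBinom = 2 * (2 * j + 1) * j.centralBinom := by
        exact_mod_cast Nat.succ_mul_centralBinom_succ j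
      have hpos : (0 : ℝ) < ((j : ℝ) + 1) ^ 2 := by positivity
      refine le_of_mul_le_mul_left ?_ hpos
      calc ((j : ℝ) + 1) ^ 2 * (((j + 1).centralBinom : ℝ) ^ 2 * (2 * ((j + 1 : ℕ) : ℝ) + 1))
          = (((j : ℝ) + 1) * (j + 1).centralBinom) ^ 2 * (2 * j + 3) := by push_cast; ring
        _ = 4 * ((2 * j + 1) * (2 * j + 3)) * ((j.centralBinom : ℝ) ^ 2 * (2 * j + 1)) := by
          rw [hrec]; ring
        _ ≤ 4 * ((2 * j + 1) * (2 * j + 3)) * (4 ^ j) ^ 2 :=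
          mul_le_mul_of_nonneg_left ih (by positivity)
        _ ≤ 4 * (4 * ((j : ℝ) + 1) ^ 2) * (4 ^ j) ^ 2 := by
          refine mul_le_mul_of_nonneg_right ?_ (by positivity)
          nlinarith
        _ = ((j : ℝ) + 1) ^ 2 * (4 ^ (j + 1)) ^ 2 := by ring
  have hs : 0 < √((j : ℝ) + 1) := Real.sqrt_pos.mpr (by positivity)
  rw [div_le_div_iff₀ (by positivity) hs, one_mul]
  refine abs_le_of_sq_le_sq' ?_ (by positivity) |>.2
  rw [mul_pow, Real.sq_sqrt (by positivity)]
  refine le_trans ?_ (h j)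
  refine mul_le_mul_of_nonneg_left ?_ (by positivity)
  have : (0 : ℝ) ≤ j := by positivity
  linarith

/-- An unbiased walk of `2 j` steps meets a given pair of neighbouring integers with probability
at most `1 / √(j + 1)`: only one of the two has the right parity. -/
theorem abs_walkStep_zero_pow_pair_le (j : ℕ) (v : ℤ) :
    |(walkStep 0 ^ (2 * j)) (fun u => if u = 0 ∨ u = 1 then 1 else 0) v| ≤ 1 / √((j : ℝ) + 1) := by
  set e : ℤ → ℝ := fun u => if u = 0 ∨ u = 1 then 1 else 0 with he
  have hpow : ∀ (N : ℕ) (v : ℤ), (walkStep 0 ^ N) e v =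
      ∑ i ∈ Finset.range (N + 1), (N.choose i : ℝ) / 2 ^ N * e (v + 2 * i - N) := by
    intro N v
    have hL : ∀ (i : ℕ) (f : ℤ → ℝ) (v : ℤ),
        ((LinearMap.funLeft ℝ ℝ (fun v : ℤ => v + 1)) ^ i) f v = f (v + i) := by
      intro i
      induction i with
      | zero => simp
      | succ i ih =>
        intro f v
        rw [pow_succ, Module.End.mul_apply, ih, LinearMap.funLeft_apply]
        push_cast; ring_nf
    have hR : ∀ (i : ℕ) (f : ℤ → ℝ) (v : ℤ),
        ((LinearMap.funLeft ℝ ℝ (fun v : ℤ => v - 1)) ^ i) f v = f (v - i) := by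
      intro i
      induction i with
      | zero => simp
      | succ i ih =>
        intro f v
        rw [pow_succ, Module.End.mul_apply, ih, LinearMap.funLeft_apply]
        push_cast; ring_nf
    have hw : walkStep 0 = (1 / 2 : ℝ) • (LinearMap.funLeft ℝ ℝ (fun v : ℤ => v + 1) +
        LinearMap.funLeft ℝ ℝ (fun v : ℤ => v - 1)) := by
      simp [walkStep]
    have hcomm : Commute (LinearMap.funLeft ℝ ℝ (fun v : ℤ => v + 1))
        (LinearMap.funLeft ℝ ℝ (fun v : ℤ => v - 1)) := by
      refine LinearMap.ext fun f => funext fun v => ?_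
      simp [LinearMap.funLeft_apply]
    rw [hw, smul_pow, hcomm.add_pow]
    simp only [LinearMap.smul_apply, LinearMap.sum_apply, Pi.smul_apply, Finset.sum_apply,
      smul_eq_mul, Finset.mul_sum]
    refine Finset.sum_congr rfl fun i hi => ?_
    have hi' : i ≤ N := Nat.lt_succ_iff.mp (Finset.mem_range.mp hi)
    rw [← Nat.cast_comm, ← nsmul_eq_mul, LinearMap.smul_apply, Pi.smul_apply,
      Module.End.mul_apply, hL, hR, nsmul_eq_mul, Nat.cast_sub hi', one_div, inv_pow,
      show v + (i : ℤ) - ((N : ℤ) - i) = v + 2 * i - N by ring]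
    ring
  have hnonneg : 0 ≤ (walkStep 0 ^ (2 * j)) e v := by
    rw [hpow]
    refine Finset.sum_nonneg fun i _ => mul_nonneg (by positivity) ?_
    simp only [he]
    split_ifs <;> norm_num
  rw [abs_of_nonneg hnonneg, hpow]
  refine le_trans ?_ (centralBinom_div_four_pow_le j)
  have hterm : ∀ i ∈ Finset.range (2 * j + 1),
      ((2 * j).choose i : ℝ) / 2 ^ (2 * j) * e (v + 2 * i - (2 * j : ℕ)) ≤
        if i = ((2 * j + 1 - v) / 2).toNat then (j.centralBinom : ℝ) / 4 ^ j else 0 := by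
    intro i _
    by_cases h : v + 2 * (i : ℤ) - (2 * j : ℕ) = 0 ∨ v + 2 * (i : ℤ) - (2 * j : ℕ) = 1
    · rw [if_pos (by push_cast at h; omega)]
      simp only [he]
      rw [if_pos h, mul_one, pow_mul, show (2 : ℝ) ^ 2 = 4 by norm_num]
      gcongr
      exact Nat.choose_le_centralBinom i j
    · simp only [he]
      rw [if_neg h, mul_zero]
      split_ifs
      · positivity
      · exact le_rfl
  refine (Finset.sum_le_sum hterm).trans ?_
  rw [Finset.sum_ite_eq']
  split_ifs
  · exact le_rfl
  · positivity

/-- `E[1 / (X + 1)] ≤ 1 / (p (q + 1))` for a binomial variable `X` with parameters `q`, `p`. -/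
theorem sum_binomial_div_succ_le {p : ℝ} (hp : 0 < p) (hp1 : p ≤ 1) (q : ℕ) :
    ∑ j ∈ Finset.range (q + 1), p ^ j * (1 - p) ^ (q - j) * (q.choose j : ℝ) * (1 / ((j : ℝ) + 1)) ≤
      1 / (p * ((q : ℝ) + 1)) := by
  rw [le_div_iff₀ (by positivity), Finset.sum_mul]
  have hb := add_pow p (1 - p) (q + 1)
  rw [add_sub_cancel, one_pow, Finset.sum_range_succ'] at hb
  have h0 : 0 ≤ p ^ 0 * (1 - p) ^ (q + 1 - 0) * ((q + 1).choose 0 : ℝ) := by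
    have : 0 ≤ 1 - p := by linarith
    positivity
  refine le_trans (le_of_eq ?_) (le_of_le_of_eq (le_add_of_nonneg_right h0) hb.symm)
  refine Finset.sum_congr rfl fun j _ => ?_
  have hc : ((q : ℝ) + 1) * q.choose j = (q + 1).choose (j + 1) * ((j : ℝ) + 1) := by
    exact_mod_cast Nat.add_one_mul_choose_eq q j
  have hj : (j : ℝ) + 1 ≠ 0 := by positivity
  rw [Nat.add_sub_add_right]
  field_simp
  linear_combination (p ^ j * p * (1 - p) ^ (q - j)) * hc

/-- The double increments of the sign function, averaged over a lazy walk, are of order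
`1 / √q`: a lazy walk of `q` steps is a mixture of unbiased walks, whose numbers of steps are
binomially distributed. -/
theorem abs_lazyWalk_pow_sign_sub_le {β : ℝ} (hβ : |β| ≤ 1 / 3) (q : ℕ) (v : ℤ) :
    |((walkStep β * walkStep (-β)) ^ q) (fun u => (u.sign : ℝ)) (v + 1) -
      ((walkStep β * walkStep (-β)) ^ q) (fun u => (u.sign : ℝ)) (v - 1)| ≤
      4 / √((q : ℝ) + 1) := by
  have hβ2 : β ^ 2 ≤ 1 / 9 := by
    rw [← sq_abs]; nlinarith [abs_nonneg β]
  set p := 1 - β ^ 2 with hp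
  have hp0 : 8 / 9 ≤ p := by linarith
  have hp1 : p ≤ 1 := by nlinarith [sq_nonneg β]
  have hβp : β ^ 2 = 1 - p := by rw [hp]; ring
  set e : ℤ → ℝ := fun u => if u = 0 ∨ u = 1 then 1 else 0 with he
  have hpow : (walkStep β * walkStep (-β)) ^ q = ∑ j ∈ Finset.range (q + 1),
      (p ^ j * (1 - p) ^ (q - j) * (q.choose j : ℝ)) • walkStep 0 ^ (2 * j) := by
    rw [walkStep_mul_walkStep_neg, ← hp, hβp,
      ((Commute.one_right _).smul_right _).add_pow]
    refine Finset.sum_congr rfl fun j _ => ?_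
    rw [smul_pow, smul_pow, one_pow, ← pow_mul, smul_mul_smul_comm, mul_one, ← Nat.cast_comm,
      ← nsmul_eq_mul, ← Nat.cast_smul_eq_nsmul ℝ, smul_smul, mul_comm (q.choose j : ℝ)]
  have htrans : ∀ (j : ℕ) (f : ℤ → ℝ) (z v : ℤ),
      (walkStep 0 ^ j) f (v + z) = (walkStep 0 ^ j) (fun u => f (u + z)) v := by
    intro j f z
    induction j with
    | zero => simp
    | succ j ih =>
      intro v
      rw [pow_succ', Module.End.mul_apply, Module.End.mul_apply, walkStep_apply, walkStep_apply,
        ← ih, ← ih, show v + z + 1 = v + 1 + z by ring, show v + z - 1 = v - 1 + z by ring]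
  have hsign : ((fun u => ((u + 1).sign : ℝ)) : ℤ → ℝ) - (fun u => ((u + -1).sign : ℝ)) =
      e + fun u => e (u + 1) := by
    funext u
    simp only [he, Pi.sub_apply, Pi.add_apply]
    rcases lt_trichotomy u 0 with h | rfl | h
    · rcases eq_or_ne u (-1) with rfl | h'
      · norm_num
      · rw [Int.sign_eq_neg_one_of_neg (by omega), Int.sign_eq_neg_one_of_neg (by omega),
          if_neg (by omega), if_neg (by omega)]
        norm_num
    · norm_num
    · rcases eq_or_ne u 1 with rfl | h'
      · norm_num
      · rw [Int.sign_eq_one_of_pos (by omega), Int.sign_eq_one_of_pos (by omega),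
          if_neg (by omega), if_neg (by omega)]
        norm_num
  have hj : ∀ j : ℕ, |(walkStep 0 ^ (2 * j)) (fun u => (u.sign : ℝ)) (v + 1) -
      (walkStep 0 ^ (2 * j)) (fun u => (u.sign : ℝ)) (v - 1)| ≤ 2 / √((j : ℝ) + 1) := by
    intro j
    rw [sub_eq_add_neg v 1, htrans, htrans, ← Pi.sub_apply, ← map_sub, hsign, map_add,
      Pi.add_apply, ← htrans]
    refine (abs_add_le _ _).trans ?_
    have h1 := abs_walkStep_zero_pow_pair_le j v
    have h2 := abs_walkStep_zero_pow_pair_le j (v + 1)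
    calc _ ≤ 1 / √((j : ℝ) + 1) + 1 / √((j : ℝ) + 1) := add_le_add h1 h2
      _ = 2 / √((j : ℝ) + 1) := by ring
  set l := √((q : ℝ) + 1) with hl
  have hl0 : 0 < l := Real.sqrt_pos.mpr (by positivity)
  have hl2 : l ^ 2 = (q : ℝ) + 1 := Real.sq_sqrt (by positivity)
  -- The inequality of the means, with weights that balance the two terms at `j = q`.
  have hamgm : ∀ j : ℕ, 2 / √((j : ℝ) + 1) ≤ 1 / l + l * (1 / ((j : ℝ) + 1)) := by
    intro j
    set s := √((j : ℝ) + 1) with hs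
    have hs0 : 0 < s := Real.sqrt_pos.mpr (by positivity)
    have hs2 : (j : ℝ) + 1 = s ^ 2 := (Real.sq_sqrt (by positivity)).symm
    rw [hs2]
    have : 1 / l + l * (1 / s ^ 2) - 2 / s = (s - l) ^ 2 / (l * s ^ 2) := by
      field_simp; ring
    have h2 : 0 ≤ (s - l) ^ 2 / (l * s ^ 2) := by positivity
    linarith
  rw [hpow]
  simp only [LinearMap.sum_apply, LinearMap.smul_apply, Finset.sum_apply, Pi.smul_apply,
    smul_eq_mul, ← Finset.sum_sub_distrib, ← mul_sub]
  have hw : ∀ j : ℕ, 0 ≤ p ^ j * (1 - p) ^ (q - j) * (q.choose j : ℝ) := by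
    intro j
    have h1 : 0 ≤ 1 - p := by linarith
    have h2 : 0 ≤ p := by linarith
    positivity
  have hsum : ∑ j ∈ Finset.range (q + 1), p ^ j * (1 - p) ^ (q - j) * (q.choose j : ℝ) = 1 := by
    rw [← add_pow, add_sub_cancel, one_pow]
  calc _ ≤ ∑ j ∈ Finset.range (q + 1), p ^ j * (1 - p) ^ (q - j) * (q.choose j : ℝ) *
        (1 / l + l * (1 / ((j : ℝ) + 1))) := by
        refine (Finset.abs_sum_le_sum_abs _ _).trans (Finset.sum_le_sum fun j _ => ?_)
        rw [abs_mul, abs_of_nonneg (hw j)]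
        exact mul_le_mul_of_nonneg_left ((hj j).trans (hamgm j)) (hw j)
    _ = 1 / l + l * ∑ j ∈ Finset.range (q + 1),
          p ^ j * (1 - p) ^ (q - j) * (q.choose j : ℝ) * (1 / ((j : ℝ) + 1)) := by
        simp only [mul_add, Finset.sum_add_distrib, ← Finset.sum_mul, hsum, one_mul,
          Finset.mul_sum]
        congr 1
        exact Finset.sum_congr rfl fun j _ => by ring
    _ ≤ 1 / l + l * (1 / (p * ((q : ℝ) + 1))) := by
        gcongr
        exact sum_binomial_div_succ_le (by linarith) hp1 q
    _ = (1 + 1 / p) / l := by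
        have : p ≠ 0 := by linarith
        rw [← hl2]; field_simp
    _ ≤ 4 / l := by
        gcongr
        have : 1 / p ≤ 1 / (8 / 9) := one_div_le_one_div_of_le (by norm_num) hp0
        norm_num at this ⊢
        linarith

/-- The mean of the sign of a walk from `0` with `q` pairs of steps of opposite biases and `d`
more steps of bias `β`. Without the last bias it would vanish by symmetry. -/
theorem abs_walk_sign_le {β : ℝ} (hβ : |β| ≤ 1 / 3) (d q : ℕ) :
    |(walkStep β ^ d * (walkStep β * walkStep (-β)) ^ q) (fun u => (u.sign : ℝ)) 0| ≤
      2 * |β| * (d / √((q : ℝ) + 1)) := by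
  have hodd : ∀ v : ℤ, (((-v).sign : ℤ) : ℝ) = -((v.sign : ℤ) : ℝ) := by
    intro v; rw [Int.sign_neg]; push_cast; ring
  have h := abs_walkStep_pow_sub_le (by linarith) (abs_lazyWalk_pow_sign_sub_le hβ q) d 0
  have h0 := walkStep_zero_pow_odd
    (walkStep_mul_walkStep_neg_pow_odd β (f := fun u => (u.sign : ℝ)) hodd q) d 0
  rw [neg_zero] at h0
  rw [show (walkStep 0 ^ d) (((walkStep β * walkStep (-β)) ^ q) (fun u => (u.sign : ℝ))) 0 = 0 by
    linarith, sub_zero] at h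
  rw [Module.End.mul_apply]
  refine h.trans (le_of_eq ?_)
  ring

namespace BinaryGame

variable {P : Type} [Fintype P] [DecidableEq P]

/-- The sum of the actions of the players in `s`, with biases `±β`, is a walk with one step for
each player. -/
theorem exists_profileExp_eq_walk {x : P → ℝ} {χ : P → ℤˣ} {β : ℝ}
    (hx : ∀ p, 2 * x p - 1 = ((χ p : ℤ) : ℝ) * β) (s : Finset P) :
    ∃ p q : ℕ, p + q = s.card ∧ (p : ℤ) - q = ∑ i ∈ s, (χ i : ℤ) ∧ ∀ (f : ℤ → ℝ) (v : ℤ),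
      profileExp x (fun a => f (v + actionSum s a)) = (walkStep β ^ p * walkStep (-β) ^ q) f v := by
  induction s using Finset.induction_on with
  | empty => exact ⟨0, 0, by simp [actionSum, profileExp_const]⟩
  | insert i s hi ih =>
    obtain ⟨p, q, hcard, hdiff, hE⟩ := ih
    have hstep : ∀ (f : ℤ → ℝ) (v : ℤ),
        profileExp x (fun a => f (v + actionSum (insert i s) a)) =
          walkStep (((χ i : ℤ) : ℝ) * β) ((walkStep β ^ p * walkStep (-β) ^ q) f) v := by
      intro f v
      rw [profileExp_eq_split x i, walkStep_apply, ← hE, ← hE, ← hx]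
      simp only [actionSum_insert_update hi, ← add_assoc]
      push_cast
      rw [← sub_eq_add_neg v 1]
      ring
    rcases Int.units_eq_one_or (χ i) with h | h
    · refine ⟨p + 1, q, ?_, ?_, fun f v => ?_⟩
      · rw [Finset.card_insert_of_notMem hi]; omega
      · rw [Finset.sum_insert hi, h, ← hdiff]; push_cast; ring
      · rw [hstep, h, ← Module.End.mul_apply, ← mul_assoc, pow_succ']
        simp
    · refine ⟨p, q + 1, ?_, ?_, fun f v => ?_⟩
      · rw [Finset.card_insert_of_notMem hi]; omega
      · rw [Finset.sum_insert hi, h, ← hdiff]; push_cast; ring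
      · rw [hstep, h, ← Module.End.mul_apply, ← mul_assoc, pow_succ', ← mul_assoc,
          ((walkStep_commute (-β) β).pow_right p).eq.symm]
        simp

/-- If the biases of the players in `s` are `±β` and the sum of their signs is of the order of
the square root of their number, then their majority has a mean of order `β`. -/
theorem abs_meanSign_le {x : P → ℝ} {χ : P → ℤˣ} {β : ℝ} (hβ : |β| ≤ 1 / 3)
    (hx : ∀ p, 2 * x p - 1 = ((χ p : ℤ) : ℝ) * β) (s : Finset P) {D : ℝ} (hD : 0 ≤ D)
    (hs : ((∑ i ∈ s, (χ i : ℤ) : ℤ) : ℝ) ^ 2 ≤ D * s.card) :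
    |meanSign x s| ≤ 2 * |β| * √(4 * D + D ^ 2) := by
  have hratio : ∀ d q : ℕ, (d : ℝ) ^ 2 ≤ D * (2 * q + d) →
      (d : ℝ) / √((q : ℝ) + 1) ≤ √(4 * D + D ^ 2) := by
    intro d q h
    have hq : 0 < √((q : ℝ) + 1) := Real.sqrt_pos.mpr (by positivity)
    rw [div_le_iff₀ hq, ← Real.sqrt_mul (by positivity)]
    refine Real.le_sqrt_of_sq_le ?_
    have h0 : (0 : ℝ) ≤ q := by positivity
    nlinarith [sq_nonneg ((d : ℝ) - D), mul_nonneg (sq_nonneg D) h0]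
  obtain ⟨p, q, hcard, hdiff, hE⟩ := exists_profileExp_eq_walk hx s
  have hmean : meanSign x s =
      (walkStep β ^ p * walkStep (-β) ^ q) (fun u => (u.sign : ℝ)) 0 := by
    rw [← hE, meanSign]
    simp only [zero_add]
  rw [← hdiff, ← hcard] at hs
  push_cast at hs
  rw [hmean]
  rcases le_total q p with h | h
  · obtain ⟨d, rfl⟩ := Nat.exists_eq_add_of_le h
    push_cast at hs
    rw [add_comm q d, pow_add, mul_assoc, ← (walkStep_commute β (-β)).mul_pow]
    refine (abs_walk_sign_le hβ d q).trans ?_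
    gcongr
    exact hratio d q (by ring_nf at hs ⊢; linarith)
  · obtain ⟨d, rfl⟩ := Nat.exists_eq_add_of_le h
    push_cast at hs
    rw [((walkStep_commute β (-β)).pow_pow p (p + d)).eq, add_comm p d, pow_add, mul_assoc,
      ← (walkStep_commute (-β) β).mul_pow]
    have h' := abs_walk_sign_le (β := -β) (by rwa [abs_neg]) d p
    rw [neg_neg, abs_neg] at h'
    refine h'.trans ?_
    gcongr
    exact hratio d p (by ring_nf at hs ⊢; linarith)

end BinaryGame

/-! ### The majority game of a balanced matrix -/

section MajorityGame

open BinaryGame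

variable {n m : ℕ} {M : Matrix (Fin n) (Fin m) ℤ} {α : ℝ}

/-- The column players that meet row `i`. -/
def rowNeighbors (M : Matrix (Fin n) (Fin m) ℤ) (i : Fin n) : Finset (Fin n ⊕ Fin m) :=
  (Finset.univ.filter fun j => M i j = 1).map Function.Embedding.inr

/-- The row players that meet column `j`. -/
def colNeighbors (M : Matrix (Fin n) (Fin m) ℤ) (j : Fin m) : Finset (Fin n ⊕ Fin m) :=
  (Finset.univ.filter fun i => M i j = 1).map Function.Embedding.inl

theorem inl_notMem_rowNeighbors (i i' : Fin n) : Sum.inl i' ∉ rowNeighbors M i := by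
  simp [rowNeighbors]

theorem inr_notMem_colNeighbors (j j' : Fin m) : Sum.inr j' ∉ colNeighbors M j := by
  simp [colNeighbors]

theorem sum_rowNeighbors (h01 : ∀ i j, M i j = 0 ∨ M i j = 1) {R : Type*} [CommRing R]
    (f : Fin n ⊕ Fin m → R) (i : Fin n) :
    ∑ q ∈ rowNeighbors M i, f q = ∑ j, (M i j : R) * f (Sum.inr j) := by
  rw [rowNeighbors, Finset.sum_map, Finset.sum_filter]
  refine Finset.sum_congr rfl fun j _ => ?_
  rcases h01 i j with h | h <;> simp [h]

theorem sum_colNeighbors (h01 : ∀ i j, M i j = 0 ∨ M i j = 1) {R : Type*} [CommRing R]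
    (f : Fin n ⊕ Fin m → R) (j : Fin m) :
    ∑ q ∈ colNeighbors M j, f q = ∑ i, (M i j : R) * f (Sum.inl i) := by
  rw [colNeighbors, Finset.sum_map, Finset.sum_filter]
  refine Finset.sum_congr rfl fun i _ => ?_
  rcases h01 i j with h | h <;> simp [h]

theorem card_rowNeighbors (h01 : ∀ i j, M i j = 0 ∨ M i j = 1) (i : Fin n) :
    ((rowNeighbors M i).card : ℝ) = rowSum M i := by
  have h := sum_rowNeighbors h01 (fun _ => (1 : ℝ)) i
  simp only [Finset.sum_const, nsmul_eq_mul, mul_one] at h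
  rw [h, rowSum]
  push_cast
  rfl

theorem card_colNeighbors (h01 : ∀ i j, M i j = 0 ∨ M i j = 1) (j : Fin m) :
    ((colNeighbors M j).card : ℝ) = colSum M j := by
  have h := sum_colNeighbors h01 (fun _ => (1 : ℝ)) j
  simp only [Finset.sum_const, nsmul_eq_mul, mul_one] at h
  rw [h, colSum]
  push_cast
  rfl

theorem sign_units_mul (b : ℤˣ) (z : ℤ) : ((b : ℤ) * z).sign = b * z.sign := by
  rcases Int.units_eq_one_or b with rfl | rfl <;> simp [Int.sign_neg]

theorem majorityGame_utility_inl (h01 : ∀ i j, M i j = 0 ∨ M i j = 1) (i : Fin n)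
    (a : Fin n ⊕ Fin m → ℤˣ) : (majorityGame M).utility (Sum.inl i) a =
      1 * ((a (Sum.inl i) : ℤ) : ℝ) * ((actionSum (rowNeighbors M i) a).sign : ℝ) := by
  have h : ∑ j, (a (Sum.inl i) : ℤ) * (a (Sum.inr j) : ℤ) * M i j =
      (a (Sum.inl i) : ℤ) * actionSum (rowNeighbors M i) a := by
    rw [actionSum, sum_rowNeighbors h01, Finset.mul_sum]
    exact Finset.sum_congr rfl fun j _ => by rw [Int.cast_id]; ring
  change ((Int.sign _ : ℤ) : ℝ) = _
  rw [h, sign_units_mul]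
  push_cast
  ring

theorem majorityGame_utility_inr (h01 : ∀ i j, M i j = 0 ∨ M i j = 1) (j : Fin m)
    (a : Fin n ⊕ Fin m → ℤˣ) : (majorityGame M).utility (Sum.inr j) a =
      (-1) * ((a (Sum.inr j) : ℤ) : ℝ) * ((actionSum (colNeighbors M j) a).sign : ℝ) := by
  have h : ∑ i, (a (Sum.inl i) : ℤ) * (a (Sum.inr j) : ℤ) * M i j =
      (a (Sum.inr j) : ℤ) * actionSum (colNeighbors M j) a := by
    rw [actionSum, sum_colNeighbors h01, Finset.mul_sum]
    exact Finset.sum_congr rfl fun i _ => by rw [Int.cast_id]; ring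
  change -((Int.sign _ : ℤ) : ℝ) = _
  rw [h, sign_units_mul]
  push_cast
  ring

/-- The equilibrium condition of the majority game in terms of the expected majorities. -/
theorem majorityGame_isApproxNash_iff (h01 : ∀ i j, M i j = 0 ∨ M i j = 1) (ε : ℝ)
    (x : Fin n ⊕ Fin m → ℝ) : (majorityGame M).IsApproxNash ε x ↔
      (∀ p, x p ∈ Set.Icc (0 : ℝ) 1) ∧
      (∀ (i : Fin n) (b : ℤˣ), (b : ℤ) * meanSign x (rowNeighbors M i) - ε ≤
        (2 * x (Sum.inl i) - 1) * meanSign x (rowNeighbors M i)) ∧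
      (∀ (j : Fin m) (b : ℤˣ), (b : ℤ) * -meanSign x (colNeighbors M j) - ε ≤
        (2 * x (Sum.inr j) - 1) * -meanSign x (colNeighbors M j)) := by
  rw [IsApproxNash, Sum.forall (p := fun p => ∀ b : ℤˣ, _ ≥ _)]
  refine and_congr_right' (and_congr ?_ ?_)
  · refine forall_congr' fun i => forall_congr' fun b => ?_
    rw [expectedUtility_update _ (inl_notMem_rowNeighbors i i) (majorityGame_utility_inl h01 i),
      expectedUtility_eq _ (inl_notMem_rowNeighbors i i) (majorityGame_utility_inl h01 i),
      two_mul_pureStrategy_sub_one, one_mul, ge_iff_le]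
  · refine forall_congr' fun j => forall_congr' fun b => ?_
    rw [expectedUtility_update _ (inr_notMem_colNeighbors j j) (majorityGame_utility_inr h01 j),
      expectedUtility_eq _ (inr_notMem_colNeighbors j j) (majorityGame_utility_inr h01 j),
      two_mul_pureStrategy_sub_one, neg_one_mul, ge_iff_le]

/-! ### Discrepancy of balanced matrices -/

theorem IsBalanced.transpose (h : IsBalanced α M) : IsBalanced α Mᵀ where
  zero_or_one i j := h.zero_or_one j i
  row_pos := h.col_pos
  col_pos := h.row_pos
  col_col := h.row_row
  row_row := h.col_col
  row_col i j := by
    obtain ⟨h1, h2⟩ := h.row_col j i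
    change 1 / α ≤ (colSum M i : ℝ) / rowSum M j ∧ (colSum M i : ℝ) / rowSum M j ≤ α
    have hr : (0 : ℝ) < rowSum M j := by exact_mod_cast h.row_pos j
    have hc : (0 : ℝ) < colSum M i := by exact_mod_cast h.col_pos i
    have hα : 0 < α := (div_pos hr hc).trans_le h2
    rw [div_le_div_iff₀ hα hc] at h1
    rw [div_le_iff₀ hc] at h2
    rw [div_le_div_iff₀ hα hr, div_le_iff₀ hr]
    constructor <;> linarith

theorem IsBalanced.rowSum_le (h : IsBalanced α M) (i i' : Fin n) :
    (rowSum M i : ℝ) ≤ |α| * rowSum M i' := by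
  have hr : (0 : ℝ) < rowSum M i' := by exact_mod_cast h.row_pos i'
  have h2 := (h.row_row i i').2
  rw [div_le_iff₀ hr] at h2
  exact h2.trans (mul_le_mul_of_nonneg_right (le_abs_self α) hr.le)

/-- A bound for the discrepancy is attained by one colouring, for all rows at once. -/
theorem disc_le_iff {B : ℝ} (hB : 0 ≤ B) :
    disc M ≤ B ↔ ∃ χ : Fin m → ℤˣ, ∀ i, |((∑ j, M i j * (χ j : ℤ) : ℤ) : ℝ)| ≤ B := by
  rw [disc, Finset.inf'_le_iff]
  simp only [Finset.mem_univ, true_and, pi_norm_le_iff_of_nonneg hB, Int.norm_eq_abs]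
  rfl

theorem BalancedBeckFialaConjecture.exists_coloring {C : ℝ}
    (hC : ∀ (n m : ℕ) [NeZero n] [NeZero m] (M : Matrix (Fin n) (Fin m) ℤ),
      IsBalanced α M → disc M ≤ C * √(rowSum M 0 : ℝ)) [NeZero n] [NeZero m]
    (h : IsBalanced α M) :
    ∃ χ : Fin m → ℤˣ, ∀ i, ((∑ j, M i j * (χ j : ℤ) : ℤ) : ℝ) ^ 2 ≤ C ^ 2 * |α| * rowSum M i := by
  have hr : (0 : ℝ) < rowSum M 0 := by exact_mod_cast h.row_pos 0
  have hd : disc M ≤ |C| * √(rowSum M 0 : ℝ) :=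
    (hC n m M h).trans (mul_le_mul_of_nonneg_right (le_abs_self C) (Real.sqrt_nonneg _))
  obtain ⟨χ, hχ⟩ := (disc_le_iff (by positivity)).mp hd
  refine ⟨χ, fun i => ?_⟩
  rw [← sq_abs]
  calc _ ≤ (|C| * √(rowSum M 0 : ℝ)) ^ 2 := pow_le_pow_left₀ (abs_nonneg _) (hχ i) 2
    _ = C ^ 2 * rowSum M 0 := by rw [mul_pow, sq_abs, Real.sq_sqrt hr.le]
    _ ≤ C ^ 2 * (|α| * rowSum M i) :=
      mul_le_mul_of_nonneg_left (h.rowSum_le 0 i) (sq_nonneg C)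
    _ = C ^ 2 * |α| * rowSum M i := by ring

theorem BalancedBeckFialaConjecture.closeEquilibriumConjecture
    (h : BalancedBeckFialaConjecture α) : CloseEquilibriumConjecture α := by
  obtain ⟨C, hC⟩ := h
  set D := C ^ 2 * |α| with hD
  have hD0 : 0 ≤ D := by positivity
  obtain ⟨N, hN⟩ := exists_nat_ge (10 * √(4 * D + D ^ 2))
  -- The expected majorities are at most `2 √(4 D + D²) / k ≤ 1 / 5`, so gains are at most `2 / 5`.
  refine ⟨2 * N + 3, ⟨N + 1, by ring⟩, fun n m _ _ M hM => ?_⟩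
  set k : ℝ := ((2 * N + 3 : ℕ) : ℝ) with hk
  have hk3 : 3 ≤ k := by rw [hk]; push_cast; linarith [(Nat.cast_nonneg N : (0 : ℝ) ≤ N)]
  have hk0 : 0 < k := by linarith
  have hkN : 10 * √(4 * D + D ^ 2) ≤ k := by
    rw [hk]; push_cast; linarith [(Nat.cast_nonneg N : (0 : ℝ) ≤ N)]
  obtain ⟨χ, hχ⟩ := BalancedBeckFialaConjecture.exists_coloring hC hM
  obtain ⟨ψ, hψ⟩ := BalancedBeckFialaConjecture.exists_coloring hC hM.transpose
  let φ : Fin n ⊕ Fin m → ℤˣ := Sum.elim ψ χ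
  let x : Fin n ⊕ Fin m → ℝ := fun p => (k + ((φ p : ℤ) : ℝ)) / (2 * k)
  have hφ : ∀ p, ((φ p : ℤ) : ℝ) = 1 ∨ ((φ p : ℤ) : ℝ) = -1 := fun p => by
    rcases Int.units_eq_one_or (φ p) with h | h <;> simp [h]
  have hxφ : ∀ p, 2 * x p - 1 = ((φ p : ℤ) : ℝ) * (1 / k) := fun p => by
    simp only [x]; field_simp; ring
  have hβ : |1 / k| ≤ 1 / 3 := by
    rw [abs_of_pos (by positivity)]
    exact one_div_le_one_div_of_le (by norm_num) hk3
  have hmean : ∀ s : Finset (Fin n ⊕ Fin m),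
      ((∑ i ∈ s, (φ i : ℤ) : ℤ) : ℝ) ^ 2 ≤ D * s.card → |meanSign x s| ≤ 1 / 5 := by
    intro s hs
    refine (abs_meanSign_le hβ hxφ s hD0 hs).trans ?_
    rw [abs_of_pos (by positivity), show 2 * (1 / k) * √(4 * D + D ^ 2) =
      2 * √(4 * D + D ^ 2) / k by ring, div_le_iff₀ hk0]
    linarith
  have hgain : ∀ (G : ℝ) (p : Fin n ⊕ Fin m) (b : ℤˣ), |G| ≤ 1 / 5 →
      (b : ℤ) * G - 0.4 ≤ (2 * x p - 1) * G := by
    intro G p b hG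
    have h1 : |((φ p : ℤ) : ℝ) * (1 / k)| ≤ 1 := by
      rw [abs_mul]
      rcases hφ p with h | h <;> rw [h] <;> norm_num at hβ ⊢ <;> linarith
    have h2 : |(2 * x p - 1) * G| ≤ 1 / 5 := by
      rw [hxφ, abs_mul]
      nlinarith [abs_nonneg G]
    have h3 := abs_le.mp h2
    have h4 := abs_le.mp hG
    norm_num
    rcases Int.units_eq_one_or b with rfl | rfl <;> push_cast <;> linarith
  refine ⟨x, fun p => ?_, (majorityGame_isApproxNash_iff hM.zero_or_one _ _).mpr
    ⟨fun p => ?_, fun i b => hgain _ _ b ?_, fun j b => hgain _ _ b ?_⟩⟩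
  · rcases hφ p with h | h
    · left; simp only [x, h]
    · right; simp only [x, h, sub_eq_add_neg]
  · rcases hφ p with h | h
    · constructor
      · simp only [x, h]; positivity
      · simp only [x, h]; rw [div_le_one (by positivity)]; linarith
    · constructor
      · simp only [x, h]; exact div_nonneg (by linarith) (by linarith)
      · simp only [x, h]; rw [div_le_one (by positivity)]; linarith
  · refine hmean _ ?_
    rw [card_rowNeighbors hM.zero_or_one, sum_rowNeighbors hM.zero_or_one]
    exact hχ i
  · rw [abs_neg]
    refine hmean _ ?_
    rw [card_colNeighbors hM.zero_or_one, sum_colNeighbors hM.zero_or_one]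
    exact hψ j

/-- In a pure equilibrium every row total is zero: weighted by the actions, the row totals and the
column totals have the same sum, and the former are nonnegative and the latter nonpositive. -/
theorem disc_eq_zero_of_pure {x : Fin n ⊕ Fin m → ℝ} (h01 : ∀ i j, M i j = 0 ∨ M i j = 1)
    (hx : ∀ p, x p = 1 ∨ x p = 0) (hN : (majorityGame M).IsApproxNash 0.4 x) : disc M ≤ 0 := by
  obtain ⟨-, hrow, hcol⟩ := (majorityGame_isApproxNash_iff h01 _ _).mp hN
  let a : Fin n ⊕ Fin m → ℤˣ := fun p => if x p = 1 then 1 else -1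
  have ha : x = fun p => pureStrategy (a p) := by
    funext p
    rcases hx p with h | h <;> simp [a, h, pureStrategy]
  have hG : ∀ s, meanSign x s = ((actionSum s a).sign : ℝ) := fun s => by
    rw [ha, meanSign, profileExp_pureStrategy]
  have hax : ∀ p, 2 * x p - 1 = ((a p : ℤ) : ℝ) := fun p => by
    rw [ha, two_mul_pureStrategy_sub_one]
  -- An action that loses could be changed with a gain of `2`.
  have hwin : ∀ (b : ℤˣ) (z : ℤ), (∀ c : ℤˣ, (c : ℤ) * (z.sign : ℝ) - 0.4 ≤ (b : ℤ) * (z.sign : ℝ)) →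
      0 ≤ (b : ℤ) * z := by
    intro b z h
    have h1 := h 1
    have h2 := h (-1)
    rcases Int.units_eq_one_or b with rfl | rfl <;> rcases lt_trichotomy z 0 with hz | rfl | hz
    · rw [Int.sign_eq_neg_one_of_neg hz] at h2; norm_num at h2
    · simp
    · simpa using hz.le
    · simpa using hz.le
    · simp
    · rw [Int.sign_eq_one_of_pos hz] at h1; norm_num at h1
  have hr : ∀ i, 0 ≤ (a (Sum.inl i) : ℤ) * actionSum (rowNeighbors M i) a := fun i =>
    hwin _ _ fun c => by
      have := hrow i c
      rwa [hG, hax] at this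
  have hc : ∀ j, (a (Sum.inr j) : ℤ) * actionSum (colNeighbors M j) a ≤ 0 := fun j => by
    have := hwin (a (Sum.inr j)) (-actionSum (colNeighbors M j) a) fun c => by
      have := hcol j c
      rw [hG, hax] at this
      rw [Int.sign_neg]
      push_cast
      exact this
    linarith
  have hsum : ∑ i, (a (Sum.inl i) : ℤ) * actionSum (rowNeighbors M i) a =
      ∑ j, (a (Sum.inr j) : ℤ) * actionSum (colNeighbors M j) a := by
    simp only [actionSum, sum_rowNeighbors h01, sum_colNeighbors h01, Finset.mul_sum]
    rw [Finset.sum_comm]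
    exact Finset.sum_congr rfl fun j _ => Finset.sum_congr rfl fun i _ => by ring
  have hzero := (Finset.sum_eq_zero_iff_of_nonneg fun i _ => hr i).mp
    (le_antisymm (hsum ▸ Finset.sum_nonpos fun j _ => hc j) (Finset.sum_nonneg fun i _ => hr i))
  refine (disc_le_iff le_rfl).mpr ⟨fun j => a (Sum.inr j), fun i => ?_⟩
  have h0 := (mul_eq_zero.mp (hzero i (Finset.mem_univ i))).resolve_left (Units.ne_zero _)
  rw [actionSum, sum_rowNeighbors h01] at h0
  simp only [Int.cast_id] at h0
  rw [h0]
  simp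

/-- An equilibrium close to `1 / 2`, but not pure, cannot have almost determined majorities, so by
Chebyshev's inequality its biases are a colouring of small discrepancy. -/
theorem disc_le_of_mixed [NeZero n] {x : Fin n ⊕ Fin m → ℝ} (hM : IsBalanced α M) {k : ℝ}
    (hk : 3 ≤ k) (hx : ∀ p, x p = (k + 1) / (2 * k) ∨ x p = (k - 1) / (2 * k))
    (hN : (majorityGame M).IsApproxNash 0.4 x) :
    disc M ≤ k * √(5 * |α|) * √(rowSum M 0 : ℝ) := by
  have hk0 : 0 < k := by linarith
  obtain ⟨hx01, hrow, -⟩ := (majorityGame_isApproxNash_iff hM.zero_or_one _ _).mp hN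
  let χ : Fin n ⊕ Fin m → ℤˣ := fun p => if x p = (k + 1) / (2 * k) then 1 else -1
  have hχ : ∀ p, k * (2 * x p - 1) = ((χ p : ℤ) : ℝ) := by
    intro p
    by_cases h : x p = (k + 1) / (2 * k)
    · simp only [χ, if_pos h, h]; push_cast; field_simp; ring
    · simp only [χ, if_neg h, (hx p).resolve_left h]; push_cast; field_simp; ring
  refine (disc_le_iff (by positivity)).mpr ⟨fun j => χ (Sum.inr j), fun i => ?_⟩
  have hG : |meanSign x (rowNeighbors M i)| ≤ 3 / 5 := by
    have h1 := hrow i 1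
    have h2 := hrow i (-1)
    have hb : |2 * x (Sum.inl i) - 1| ≤ 1 / 3 := by
      have h3 : |k * (2 * x (Sum.inl i) - 1)| = 1 := by
        rw [hχ]
        rcases Int.units_eq_one_or (χ (Sum.inl i)) with h | h <;> simp [h]
      rw [abs_mul, abs_of_pos hk0] at h3
      nlinarith [abs_nonneg (2 * x (Sum.inl i) - 1)]
    generalize meanSign x (rowNeighbors M i) = G at *
    generalize 2 * x (Sum.inl i) - 1 = b at *
    have hb' := abs_le.mp hb
    norm_num at h1 h2
    rw [abs_le]
    constructor
    · by_contra! hlt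
      nlinarith
    · by_contra! hlt
      nlinarith
  have hcheb := sq_mul_one_sub_abs_meanSign_le hx01 (rowNeighbors M i)
  rw [card_rowNeighbors hM.zero_or_one] at hcheb
  set μ := ∑ q ∈ rowNeighbors M i, (2 * x q - 1) with hμ
  have hμχ : ((∑ j, M i j * (χ (Sum.inr j) : ℤ) : ℤ) : ℝ) = k * μ := by
    rw [hμ, Finset.mul_sum, sum_rowNeighbors hM.zero_or_one]
    push_cast
    exact Finset.sum_congr rfl fun j _ => by rw [hχ]
  have hμ2 : μ ^ 2 ≤ 5 * rowSum M i := by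
    nlinarith [mul_le_mul_of_nonneg_left hG (sq_nonneg μ)]
  have hr : (0 : ℝ) ≤ rowSum M 0 := by exact_mod_cast (hM.row_pos 0).le
  rw [hμχ, abs_mul, abs_of_pos hk0, mul_assoc]
  refine mul_le_mul_of_nonneg_left ?_ hk0.le
  rw [← Real.sqrt_mul (by positivity)]
  refine Real.abs_le_sqrt ?_
  linarith [hM.rowSum_le i 0]

theorem CloseEquilibriumConjecture.balancedBeckFialaConjecture
    (h : CloseEquilibriumConjecture α) : BalancedBeckFialaConjecture α := by
  obtain ⟨k, hk, h⟩ := h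
  refine ⟨k * √(5 * |α|), fun n m _ _ M hM => ?_⟩
  obtain ⟨x, hx, hN⟩ := h n m M hM
  by_cases hk1 : k = 1
  · subst hk1
    refine (disc_eq_zero_of_pure hM.zero_or_one (fun p => ?_) hN).trans (by positivity)
    have := hx p
    norm_num at this
    exact this
  · refine disc_le_of_mixed hM ?_ hx hN
    obtain ⟨l, rfl⟩ := hk
    exact_mod_cast (show 3 ≤ 2 * l + 1 by omega)

end MajorityGame

theorem theorem2 (α : ℝ) :
    BalancedBeckFialaConjecture α ↔ CloseEquilibriumConjecture α :=
  ⟨fun h => h.closeEquilibriumConjecture, fun h => h.balancedBeckFialaConjecture⟩
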